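/- Let $k$ be a field and let $\mathcal B$ be a $k$-linear abelian category such that, for all objects $X,Y$, the spaces $\operatorname{Ext}^i_{\mathcal B}(X,Y)$, $i\ge 0$ (in particular $\operatorname{Hom}(X,Y)=\operatorname{Ext}^0(X,Y)$), are finite dimensional over $k$ and only finitely many of them are non-zero. An object $T$ of $\mathcal B$ is called exceptional if $\operatorname{Ext}^i_{\mathcal B}(T,T)=0$ for $i>0$ and $\operatorname{End}_{\mathcal B}(T)$ is a division algebra; a sequence $T_1,\dots,T_n$ of exceptional objects is an exceptional collection if $\operatorname{Ext}^m_{\mathcal B}(T_i,T_j)=0$ for all $m$ and all $j>i$. An object $T$ has projective dimension $\le 1$ if $\operatorname{Ext}^s_{\mathcal B}(T,-)=0$ for all $s>1$. Let $T_1,\dots,T_n$ be an exceptional collection in $\mathcal B$ consisting of objects of projective dimension $\le 1$, put $T=\bigoplus_{i=1}^n T_i$, and let $T^\perp$ be the full subcategory of $\mathcal B$ whose objects are the $X$ with $\operatorname{Ext}^i_{\mathcal B}(T,X)=0$ for all $i\ge 0$ (this is an abelian category, since $T$ has projective dimension $\le 1$). Then there is an isomorphism of abelian groups $$K_0(\mathcal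 B)\;\cong\;\mathbb Z^n\oplus K_0(T^\perp),$$ where $K_0$ of an abelian category is the abelian group generated by the symbols $[X]$, $X$ an object, subject to the relations $[X_2]=[X_1]+[X_3]$ for every short exact sequence $0\to X_1\to X_2\to X_3\to 0$ in that category. -/

import Mathlib

open CategoryTheory CategoryTheory.Limits CategoryTheory.Abelian
open scoped ZeroObject

attribute [local instance] Abelian.hasFiniteBiproducts

universe w v u t

namespace ExceptionalCollection

noncomputable section

section GrothendieckGroup

variable (A : Type u) [Category.{v} A] [Abelian A]

/-- The subgroup of the free abelian group on the objects of `A` that is generated by the elements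
`[X₂] - [X₁] - [X₃]`, one for each short exact sequence `0 ⟶ X₁ ⟶ X₂ ⟶ X₃ ⟶ 0` in `A`. -/
def shortExactRelations : AddSubgroup (FreeAbelianGroup A) :=
  AddSubgroup.closure
    {x | ∃ S : ShortComplex A, S.ShortExact ∧
      x = FreeAbelianGroup.of S.X₂ - FreeAbelianGroup.of S.X₁ - FreeAbelianGroup.of S.X₃}

/-- The Grothendieck group `K₀(A)` of an abelian category `A`. -/
abbrev K0 : Type u := FreeAbelianGroup A ⧸ shortExactRelations A

end GrothendieckGroup

variable {C : Type u} [Category.{v} C] [Abelian C] [HasExt.{w} C]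

/-- The standing finiteness condition on a `k`-linear abelian category: all `Extⁱ(X, Y)`
(in particular all `Hom(X, Y) = Ext⁰(X, Y)`) are finite dimensional over `k`, and for fixed `X, Y`
only finitely many of them are non-zero. -/
structure IsExtFinite (k : Type t) [Field k] (C : Type u) [Category.{v} C] [Abelian C]
    [Linear k C] [HasExt.{w} C] : Prop where
  finite_ext (X Y : C) (i : ℕ) : Module.Finite k (Ext.{w} X Y i)
  finite_degrees (X Y : C) : {i : ℕ | Nontrivial (Ext.{w} X Y i)}.Finite

/-- An object `T` is exceptional if `Extⁱ(T, T) = 0` for `i > 0` and `End(T)` is a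
division ring. -/
structure IsExceptional (T : C) : Prop where
  ext_eq_zero (i : ℕ) (hi : 0 < i) : Subsingleton (Ext.{w} T T i)
  nontrivial_end : Nontrivial (End T)
  isUnit_of_ne_zero (f : End T) (hf : f ≠ 0) : IsUnit f

/-- A sequence of exceptional objects is an exceptional collection if `Ext^*(Tᵢ, Tⱼ) = 0`
for `j > i`. -/
structure IsExceptionalCollection {n : ℕ} (T : Fin n → C) : Prop where
  isExceptional (i : Fin n) : IsExceptional.{w} (T i)
  ext_eq_zero (i j : Fin n) (hij : i < j) (m : ℕ) : Subsingleton (Ext.{w} (T i) (T j) m)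

/-- The right perpendicular `T^⊥`: the objects `X` with `Extⁱ(T, X) = 0` for all `i`. -/
def rightPerp (T : C) : ObjectProperty C :=
  fun X => ∀ i : ℕ, Subsingleton (Ext.{w} T X i)

/-! If `T` has projective dimension at most one, then the full subcategory `T^⊥` is an abelian
category (with kernels, cokernels and finite products computed in the ambient category). -/

section Abelian

lemma ext_subsingleton_iff {X Y : C} {i : ℕ} :
    Subsingleton (Ext.{w} X Y i) ↔ ∀ e : Ext.{w} X Y i, e = 0 :=
  ⟨fun _ e => Subsingleton.elim e 0, fun h => ⟨fun a b => (h a).trans (h b).symm⟩⟩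

lemma rightPerp_of_iso (T : C) {X Y : C} (e : X ≅ Y) (hX : rightPerp.{w} T X) :
    rightPerp.{w} T Y := by
  intro i
  have := hX i
  rw [ext_subsingleton_iff]
  intro x
  have h : x.comp (Ext.mk₀ e.inv) (add_zero i) = 0 := Subsingleton.elim _ _
  calc x = (x.comp (Ext.mk₀ e.inv) (add_zero i)).comp (Ext.mk₀ e.hom) (add_zero i) := by simp
    _ = 0 := by rw [h, Ext.zero_comp]

instance (T : C) : (rightPerp.{w} T).IsClosedUnderIsomorphisms where
  of_iso e hX := rightPerp_of_iso T e hX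

instance (T : C) : (rightPerp.{w} T).ContainsZero where
  exists_zero := ⟨0, isZero_zero C, fun i => by
    rw [ext_subsingleton_iff]
    intro x
    have h : Ext.mk₀ (𝟙 (0 : C)) = 0 := by
      rw [(isZero_zero C).eq_of_src (𝟙 (0 : C)) 0, Ext.mk₀_zero]
    calc x = x.comp (Ext.mk₀ (𝟙 (0 : C))) (add_zero i) := (Ext.comp_mk₀_id x).symm
      _ = 0 := by rw [h, Ext.comp_zero]⟩

instance (T : C) : (rightPerp.{w} T).IsClosedUnderFiniteProducts where
  isClosedUnderLimitsOfShape J _ := ⟨by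
    have := Fintype.ofFinite J
    rintro X ⟨p⟩
    have e : (⨁ fun j => p.diag.obj ⟨j⟩) ≅ X :=
      biproduct.isoProduct _ ≪≫ HasLimit.isoOfNatIso Discrete.natIsoFunctor.symm ≪≫
        (limit.isLimit p.diag).conePointUniqueUpToIso p.isLimit
    refine rightPerp_of_iso T e fun i => ?_
    have h (j : J) : Subsingleton (Ext.{w} T (p.diag.obj ⟨j⟩) i) := p.prop_diag_obj ⟨j⟩ i
    exact (Ext.addEquivBiproduct T (biproduct.isBilimit fun j => p.diag.obj ⟨j⟩) i).subsingleton⟩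

lemma rightPerp_kernel_cokernel (T : C) [HasProjectiveDimensionLE T 1] {X Y : C} (f : X ⟶ Y)
    (hX : rightPerp.{w} T X) (hY : rightPerp.{w} T Y) :
    rightPerp.{w} T (kernel f) ∧ rightPerp.{w} T (cokernel f) := by
  have hS₁ : (ShortComplex.mk (kernel.ι f) (cokernel.π (kernel.ι f))
      (cokernel.condition _)).ShortExact :=
    { exact := ShortComplex.exact_of_g_is_cokernel _ (cokernelIsCokernel _) }
  have hS₂ : (ShortComplex.mk (kernel.ι (cokernel.π f)) (cokernel.π f)
      (kernel.condition _)).ShortExact :=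
    { exact := ShortComplex.exact_of_f_is_kernel _ (kernelIsKernel _) }
  have mono_zero {M N : C} (g : M ⟶ N) [Mono g] (hN : rightPerp.{w} T N) :
      Subsingleton (Ext.{w} T M 0) := by
    have := hN 0
    exact (Ext.postcomp_mk₀_injective_of_mono T g).subsingleton
  have hI : rightPerp.{w} T (Abelian.image f) := by
    intro i
    obtain _ | i := i
    · exact mono_zero (Abelian.image.ι f) hY
    · have hc : Subsingleton (Ext.{w} T (Abelian.coimage f) (i + 1)) := by
        rw [ext_subsingleton_iff]
        intro x
        have := hX (i + 1)
        obtain ⟨y, hy⟩ := Ext.covariant_sequence_exact₃ T hS₁ x rfl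
          (Ext.eq_zero_of_hasProjectiveDimensionLT _ 2 (by omega))
        rw [← hy, Subsingleton.elim y 0, Ext.zero_comp]
      rw [ext_subsingleton_iff] at hc ⊢
      intro x
      have h := hc (x.comp (Ext.mk₀ (Abelian.coimageIsoImage f).inv) (add_zero _))
      calc x = (x.comp (Ext.mk₀ (Abelian.coimageIsoImage f).inv) (add_zero _)).comp
            (Ext.mk₀ (Abelian.coimageIsoImage f).hom) (add_zero _) := by simp
        _ = 0 := by rw [h, Ext.zero_comp]
  have hc : rightPerp.{w} T (Abelian.coimage f) :=
    rightPerp_of_iso T (Abelian.coimageIsoImage f).symm hI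
  refine ⟨fun i => ?_, fun i => ?_⟩
  · obtain _ | i := i
    · exact mono_zero (kernel.ι f) hX
    · rw [ext_subsingleton_iff]
      intro x
      have := hX (i + 1)
      have := hc i
      obtain ⟨y, hy⟩ := Ext.covariant_sequence_exact₁ T hS₁ x (Subsingleton.elim _ _) rfl
      rw [← hy, show y = 0 from Subsingleton.elim (α := Ext T (Abelian.coimage f) i) y 0,
        Ext.zero_comp]
  · rw [ext_subsingleton_iff]
    intro x
    have := hY i
    have := hI (i + 1)
    obtain ⟨y, hy⟩ := Ext.covariant_sequence_exact₃ T hS₂ x rfl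
      (Subsingleton.elim (α := Ext T (Abelian.image f) (i + 1)) _ _)
    rw [← hy, Subsingleton.elim y 0, Ext.zero_comp]

instance (T : C) [HasProjectiveDimensionLE T 1] : (rightPerp.{w} T).IsClosedUnderKernels where
  kernels_le := by
    rintro _ ⟨f, k, hk, hf⟩
    exact rightPerp_of_iso T ((kernelIsKernel f).conePointUniqueUpToIso hk)
      (rightPerp_kernel_cokernel T f hf.1 hf.2).1

instance (T : C) [HasProjectiveDimensionLE T 1] : (rightPerp.{w} T).IsClosedUnderCokernels where
  cokernels_le := by
    rintro _ ⟨f, k, hk, hf⟩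
    exact rightPerp_of_iso T ((cokernelIsCokernel f).coconePointUniqueUpToIso hk)
      (rightPerp_kernel_cokernel T f hf.1 hf.2).2

instance rightPerpAbelian (T : C) [HasProjectiveDimensionLE T 1] :
    Abelian (rightPerp.{w} T).FullSubcategory :=
  inferInstance

/-- A finite direct sum of objects of projective dimension at most one is again such. -/
instance biproduct_projectiveDimension {C : Type u} [Category.{v} C] [Abelian C] {n : ℕ}
    (T : Fin n → C) [∀ i, HasProjectiveDimensionLE (T i) 1] :
    HasProjectiveDimensionLE (⨁ T) 1 where
  subsingleton' i hi Y := by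
    let := HasExt.standard C
    have h (j : Fin n) : Subsingleton (Ext.{max u v} (T j) Y i) :=
      HasProjectiveDimensionLT.subsingleton (T j) 2 i hi Y
    exact (Ext.biproductAddEquiv (biproduct.isBilimit T) Y i).subsingleton

end Abelian

end

end ExceptionalCollection

open ExceptionalCollection

/-! The objects are split off one at a time. Let `P` be a wide subcategory containing an exceptional
`T` of projective dimension at most one; the claim is K₀(P) ≅ ℤ ⊕ K₀(P ∩ T^⊥)
(`nonempty_equiv_of_isExceptional`).

If Ext¹(T, X) = 0, the universal map f : T^a ⟶ X from copies of `T` has kernel and cokernel in T^⊥.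
Since [X] = a[T] + [coker f] - [ker f], the candidate isomorphism sends [X] to (a, [coker f] - [ker
f]). Coreflections of the outer terms of a short exact sequence combine into one of the middle term,
and the snake lemma gives additivity (`exists_isAdditiveOn_coreflection`).

A general X embeds in some Y with Ext¹(T, Y) = 0, by repeatedly forming nonsplit extensions by `T`.
Quotients of such Y have the same property because Ext²(T, -) = 0. Hence the additive function
extends uniquely to all of `P`, as in the resolution theorem (`IsCoresolving.exists_extension`,
`IsCoresolving.eq_of_eq`).

For a collection, the later objects lie in the perpendicular category of the first one, which is
again wide, so induction applies. All Ext groups are taken in the ambient category throughout; only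
at the end are ambient and intrinsic exactness in T^⊥ compared. -/

namespace ExceptionalCollection

/-! ### Realizing Ext¹ classes by short exact sequences. -/

section Realization

open Pretriangulated DerivedCategory

variable {C : Type u} [Category.{v} C] [Abelian C]

/-- A short complex that becomes a distinguished triangle in the derived category is short exact. -/
lemma shortExact_of_distinguished [HasDerivedCategory.{w} C] {X E Z : C} (f : X ⟶ E) (g : E ⟶ Z)
    (h : (singleFunctor C 0).obj Z ⟶ ((singleFunctor C 0).obj X)⟦(1 : ℤ)⟧)
    (hT : Triangle.mk ((singleFunctor C 0).map f) ((singleFunctor C 0).map g) h ∈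
      distTriang (DerivedCategory C)) :
    ∃ w : f ≫ g = 0, (ShortComplex.mk f g w).ShortExact := by
  have w : f ≫ g = 0 := (singleFunctor C 0).map_injective (by
    rw [Functor.map_comp, Functor.map_zero]
    exact comp_distTriang_mor_zero₁₂ _ hT)
  refine ⟨w, ?_⟩
  let F := singleFunctor C 0 ⋙ homologyFunctor C 0
  have h₂ := HomologySequence.exact₂ _ hT 0
  -- The stalk complexes of `Z` and `X` have no homology in degrees -1 and 1 respectively, so both
  -- connecting maps next to H⁰ vanish.
  have hm := (HomologySequence.mono_homologyMap_mor₁_iff _ hT (-1) 0).2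
    ((isZero_of_isGE ((singleFunctor C 0).obj Z) 0 (-1) (by lia)).eq_of_src _ _)
  have he := (HomologySequence.epi_homologyMap_mor₂_iff _ hT 0 1).2
    ((isZero_of_isLE ((singleFunctor C 0).obj X) 0 1 (by lia)).eq_of_tgt _ _)
  have hS : ((ShortComplex.mk f g w).map F).ShortExact :=
    { exact := h₂, mono_f := hm, epi_g := he }
  exact ShortComplex.shortExact_of_iso
    ((ShortComplex.mk f g w).mapNatIso (singleFunctorCompHomologyFunctorIso C 0)) hS

/-- Every class in `Ext¹(Z, X)` is annihilated by the inclusion of `X` in some extension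
of `Z` by `X`. -/
lemma exists_shortExact_comp_eq_zero [HasExt.{w} C] {X Z : C} (e : Ext.{w} Z X 1) :
    ∃ (E : C) (f : X ⟶ E) (g : E ⟶ Z) (w : f ≫ g = 0), (ShortComplex.mk f g w).ShortExact ∧
      e.comp (Ext.mk₀ f) (add_zero 1) = 0 := by
  let := HasDerivedCategory.standard C
  -- Completing the class Z ⟶ X[1] to a triangle gives a middle term between two objects
  -- concentrated in degree 0, hence itself isomorphic to an object of `C`.
  obtain ⟨E, f, g, hT⟩ := distinguished_cocone_triangle₂ e.hom
  have hGE : E.IsGE 0 := by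
    rw [isGE_iff]
    intro i hi
    exact (HomologySequence.exact₂ _ hT i).isZero_of_both_zeros
      ((isZero_of_isGE ((singleFunctor C 0).obj X) 0 i hi).eq_of_src _ _)
      ((isZero_of_isGE ((singleFunctor C 0).obj Z) 0 i hi).eq_of_tgt _ _)
  have hLE : E.IsLE 0 := by
    rw [isLE_iff]
    intro i hi
    exact (HomologySequence.exact₂ _ hT i).isZero_of_both_zeros
      ((isZero_of_isLE ((singleFunctor C 0).obj X) 0 i hi).eq_of_src _ _)
      ((isZero_of_isLE ((singleFunctor C 0).obj Z) 0 i hi).eq_of_tgt _ _)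
  obtain ⟨Y, ⟨φ⟩⟩ := exists_iso_singleFunctor_obj_of_isGE_of_isLE E 0
  obtain ⟨f', hf'⟩ := (singleFunctor C 0).map_surjective (f ≫ φ.hom)
  obtain ⟨g', hg'⟩ := (singleFunctor C 0).map_surjective (φ.inv ≫ g)
  have hT' : Triangle.mk ((singleFunctor C 0).map f') ((singleFunctor C 0).map g') e.hom ∈
      distTriang (DerivedCategory C) := by
    refine isomorphic_distinguished _ hT _ (Triangle.isoMk _ _ (Iso.refl _) φ.symm (Iso.refl _)
      ?_ ?_ ?_)
    · change (singleFunctor C 0).map f' ≫ φ.inv = 𝟙 _ ≫ f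
      simp [hf']
    · change (singleFunctor C 0).map g' ≫ 𝟙 _ = φ.inv ≫ g
      simp [hg']
    · change e.hom ≫ (shiftFunctor (DerivedCategory C) (1 : ℤ)).map (𝟙 _) = 𝟙 _ ≫ e.hom
      simp
  obtain ⟨w, hS⟩ := shortExact_of_distinguished f' g' _ hT'
  refine ⟨Y, f', g', w, hS, ?_⟩
  ext
  simp only [Ext.comp_hom, Ext.mk₀_hom, Ext.zero_hom,
    ShiftedHom.comp_mk₀]
  exact comp_distTriang_mor_zero₃₁ _ hT'

end Realization

/-! ### Wide subcategories and additive functions. -/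

noncomputable section

variable {C : Type u} [Category.{v} C] [Abelian C]

/-- A full subcategory of an abelian category that is closed under kernels, cokernels and
extensions. -/
structure IsWide (P : ObjectProperty C) : Prop where
  of_iso {X Y : C} (e : X ≅ Y) (hX : P X) : P Y
  zero : P 0
  kernel {X Y : C} (f : X ⟶ Y) (hX : P X) (hY : P Y) : P (kernel f)
  cokernel {X Y : C} (f : X ⟶ Y) (hX : P X) (hY : P Y) : P (cokernel f)
  extension {S : ShortComplex C} (hS : S.ShortExact) (h₁ : P S.X₁) (h₃ : P S.X₃) : P S.X₂

namespace IsWide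

variable {P : ObjectProperty C} (hP : IsWide P)

include hP

lemma image {X Y : C} (f : X ⟶ Y) (hX : P X) (hY : P Y) : P (Abelian.image f) :=
  hP.kernel _ hY (hP.cokernel f hX hY)

lemma of_isZero {X : C} (hX : IsZero X) : P X :=
  hP.of_iso ((isZero_zero C).iso hX) hP.zero

lemma biprod {X Y : C} (hX : P X) (hY : P Y) : P (X ⊞ Y) :=
  hP.extension (ShortComplex.Splitting.ofHasBinaryBiproduct X Y).shortExact hX hY

end IsWide

/-- A function on objects is additive on `P` if it is additive on the short exact sequences with
terms in `P`. -/
def IsAdditiveOn {G : Type*} [AddCommGroup G] (P : ObjectProperty C) (φ : C → G) : Prop :=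
  ∀ S : ShortComplex C, S.ShortExact → P S.X₁ → P S.X₂ → P S.X₃ → φ S.X₂ = φ S.X₁ + φ S.X₃

lemma shortExact_kernel_image {X Y : C} (f : X ⟶ Y) :
    (ShortComplex.mk (kernel.ι f) (Abelian.factorThruImage f) (by
      rw [← cancel_mono (Abelian.image.ι f)]; simp)).ShortExact where
  exact := by
    rw [ShortComplex.exact_iff_exact_up_to_refinements]
    intro A x hx
    have hx' : x ≫ f = 0 := by simpa using hx =≫ Abelian.image.ι f
    exact ⟨A, 𝟙 A, inferInstance, kernel.lift f x hx', by simp⟩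

lemma shortExact_image_cokernel {X Y : C} (f : X ⟶ Y) :
    (ShortComplex.mk (Abelian.image.ι f) (cokernel.π f) (kernel.condition _)).ShortExact where
  exact := ShortComplex.exact_of_f_is_kernel _ (kernelIsKernel _)

lemma shortExact_cokernel {X Y : C} (f : X ⟶ Y) [Mono f] :
    (ShortComplex.mk f (cokernel.π f) (cokernel.condition f)).ShortExact where
  exact := ShortComplex.exact_cokernel f

namespace IsAdditiveOn

variable {G : Type*} [AddCommGroup G] {P : ObjectProperty C} {φ : C → G}

lemma mono {P' : ObjectProperty C} (hφ : IsAdditiveOn P φ) (h : P' ≤ P) : IsAdditiveOn P' φ :=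
  fun S hS h₁ h₂ h₃ => hφ S hS (h _ h₁) (h _ h₂) (h _ h₃)

lemma map_isZero (hφ : IsAdditiveOn P φ) {X : C} (hX : IsZero X) (hPX : P X) : φ X = 0 := by
  have hS : (ShortComplex.mk (𝟙 X) (0 : X ⟶ X) (by simp)).ShortExact :=
    { exact := by
        rw [ShortComplex.exact_iff_epi _ (by rfl)]
        exact inferInstanceAs (Epi (𝟙 X))
      mono_f := inferInstanceAs (Mono (𝟙 X))
      epi_g := ⟨fun _ _ _ => hX.eq_of_src _ _⟩ }
  have := hφ _ hS hPX hPX hPX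
  simpa using this

lemma map_iso (hφ : IsAdditiveOn P φ) (h0 : P 0) {X Y : C} (e : X ≅ Y) (hX : P X) (hY : P Y) :
    φ X = φ Y := by
  have hS : (ShortComplex.mk e.hom (0 : Y ⟶ 0) (by simp)).ShortExact :=
    { exact := by
        rw [ShortComplex.exact_iff_epi _ (by rfl)]
        exact inferInstanceAs (Epi e.hom)
      mono_f := inferInstanceAs (Mono e.hom)
      epi_g := ⟨fun _ _ _ => (isZero_zero C).eq_of_src _ _⟩ }
  have := hφ _ hS hX hY h0
  rw [hφ.map_isZero (isZero_zero C) h0, add_zero] at this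
  exact this.symm

variable (hφ : IsAdditiveOn P φ) (hP : IsWide P)

include hφ hP

lemma map_eq_kernel_add_image {X Y : C} (f : X ⟶ Y) (hX : P X) (hY : P Y) :
    φ X = φ (kernel f) + φ (Abelian.image f) :=
  hφ _ (shortExact_kernel_image f) (hP.kernel f hX hY) hX (hP.image f hX hY)

lemma map_eq_image_add_cokernel {X Y : C} (f : X ⟶ Y) (hX : P X) (hY : P Y) :
    φ Y = φ (Abelian.image f) + φ (cokernel f) :=
  hφ _ (shortExact_image_cokernel f) (hP.image f hX hY) hY (hP.cokernel f hX hY)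

lemma map_image_eq_map_kernel {S : ShortComplex C} (hS : S.Exact) (h₁ : P S.X₁) (h₂ : P S.X₂)
    (h₃ : P S.X₃) : φ (Abelian.image S.f) = φ (kernel S.g) := by
  have e : Abelian.image S.f ≅ kernel S.g :=
    IsLimit.conePointUniqueUpToIso hS.isLimitImage (limit.isLimit _)
  exact hφ.map_iso hP.zero e (hP.image _ h₁ h₂) (hP.kernel _ h₂ h₃)

lemma map_exact {S : ShortComplex C} (hS : S.Exact) (h₁ : P S.X₁) (h₂ : P S.X₂)
    (h₃ : P S.X₃) : φ S.X₂ = φ (Abelian.image S.f) + φ (Abelian.image S.g) := by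
  rw [hφ.map_image_eq_map_kernel hP hS h₁ h₂ h₃, hφ.map_eq_kernel_add_image hP S.g h₂ h₃]

lemma map_image_of_mono {X Y : C} (f : X ⟶ Y) [Mono f] (hX : P X) (hY : P Y) :
    φ (Abelian.image f) = φ X := by
  rw [hφ.map_eq_kernel_add_image hP f hX hY,
    hφ.map_isZero (isZero_kernel_of_mono f) (hP.kernel f hX hY), zero_add]

lemma map_image_of_epi {X Y : C} (f : X ⟶ Y) [Epi f] (hX : P X) (hY : P Y) :
    φ (Abelian.image f) = φ Y := by
  rw [hφ.map_eq_image_add_cokernel hP f hX hY,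
    hφ.map_isZero (isZero_cokernel_of_epi f) (hP.cokernel f hX hY), add_zero]

/-- Additivity of the class `[coker] - [ker]`, a consequence of the snake lemma. -/
lemma snake (S : ShortComplex.SnakeInput C) [Mono S.L₀.f] [Epi S.L₃.g]
    (h₁ : P S.L₀.X₁) (h₂ : P S.L₀.X₂) (h₃ : P S.L₀.X₃)
    (h₁' : P S.L₃.X₁) (h₂' : P S.L₃.X₂) (h₃' : P S.L₃.X₃) :
    φ S.L₃.X₂ - φ S.L₀.X₂ = (φ S.L₃.X₁ - φ S.L₀.X₁) + (φ S.L₃.X₃ - φ S.L₀.X₃) := by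
  -- The six-term kernel-cokernel sequence is cut into its images, which cancel in the alternating
  -- sum.
  have e₁ := hφ.map_exact hP S.L₀_exact h₁ h₂ h₃
  have e₂ : φ S.L₀.X₃ = φ (Abelian.image S.L₀.g) + φ (Abelian.image S.δ) :=
    hφ.map_exact hP S.L₁'_exact h₂ h₃ h₁'
  have e₃ : φ S.L₃.X₁ = φ (Abelian.image S.δ) + φ (Abelian.image S.L₃.f) :=
    hφ.map_exact hP S.L₂'_exact h₃ h₁' h₂'
  have e₄ := hφ.map_exact hP S.L₃_exact h₁' h₂' h₃'
  rw [hφ.map_image_of_mono hP _ h₁ h₂] at e₁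
  rw [hφ.map_image_of_epi hP _ h₂' h₃'] at e₄
  rw [e₁, e₂, e₃, e₄]
  abel

/-- The class `[coker] - [ker]` is additive in morphisms of short exact sequences. -/
lemma map_cokernel_sub_map_kernel {S₁ S₂ : ShortComplex C} (α : S₁ ⟶ S₂) (hS₁ : S₁.ShortExact)
    (hS₂ : S₂.ShortExact) (h₁ : P (kernel α.τ₁)) (h₂ : P (kernel α.τ₂)) (h₃ : P (kernel α.τ₃))
    (h₁' : P (cokernel α.τ₁)) (h₂' : P (cokernel α.τ₂)) (h₃' : P (cokernel α.τ₃)) :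
    φ (cokernel α.τ₂) - φ (kernel α.τ₂) =
      (φ (cokernel α.τ₁) - φ (kernel α.τ₁)) + (φ (cokernel α.τ₃) - φ (kernel α.τ₃)) := by
  have := hS₁.mono_f
  have := hS₂.epi_g
  -- The snake lemma is applied in `C`; only the kernels and cokernels, not the two sequences
  -- themselves, have to lie in `P`.
  let D : ShortComplex.SnakeInput C :=
    { L₀ := ShortComplex.mk (kernel.map α.τ₁ α.τ₂ S₁.f S₂.f α.comm₁₂)
        (kernel.map α.τ₂ α.τ₃ S₁.g S₂.g α.comm₂₃) (by ext; simp)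
      L₁ := S₁
      L₂ := S₂
      L₃ := ShortComplex.mk (cokernel.map α.τ₁ α.τ₂ S₁.f S₂.f α.comm₁₂)
        (cokernel.map α.τ₂ α.τ₃ S₁.g S₂.g α.comm₂₃) (by ext; simp)
      v₀₁ := { τ₁ := kernel.ι _, τ₂ := kernel.ι _, τ₃ := kernel.ι _ }
      v₁₂ := α
      v₂₃ := { τ₁ := cokernel.π _, τ₂ := cokernel.π _, τ₃ := cokernel.π _ }
      h₀ := by
        apply ShortComplex.isLimitOfIsLimitπ <;>
          apply (KernelFork.isLimitMapConeEquiv _ _).2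
        all_goals exact kernelIsKernel _
      h₃ := by
        apply ShortComplex.isColimitOfIsColimitπ <;>
          apply (CokernelCofork.isColimitMapCoconeEquiv _ _).2
        all_goals exact cokernelIsCokernel _
      L₁_exact := hS₁.exact
      epi_L₁_g := hS₁.epi_g
      L₂_exact := hS₂.exact
      mono_L₂_f := hS₂.mono_f }
  have hm : Mono D.L₀.f := by
    have : Mono (kernel.map α.τ₁ α.τ₂ S₁.f S₂.f α.comm₁₂ ≫ kernel.ι α.τ₂) := by
      rw [kernel.lift_ι]
      infer_instance
    exact mono_of_mono _ (kernel.ι α.τ₂)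
  have he : Epi D.L₃.g := by
    have : Epi (cokernel.π α.τ₂ ≫ cokernel.map α.τ₂ α.τ₃ S₁.g S₂.g α.comm₂₃) := by
      rw [cokernel.π_desc]
      infer_instance
    exact epi_of_epi (cokernel.π α.τ₂) _
  exact hφ.snake hP D h₁ h₂ h₃ h₁' h₂' h₃'

end IsAdditiveOn

/-! ### Grothendieck groups relative to ambient exact sequences. -/

section K0On

variable (P : ObjectProperty C)

/-- The relations `[X₂] - [X₁] - [X₃]` for the short exact sequences with terms in `P`. -/
def relationsOn : AddSubgroup (FreeAbelianGroup P.FullSubcategory) :=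
  AddSubgroup.closure
    {x | ∃ (S : ShortComplex C) (h₁ : P S.X₁) (h₂ : P S.X₂) (h₃ : P S.X₃), S.ShortExact ∧
      x = FreeAbelianGroup.of ⟨S.X₂, h₂⟩ - FreeAbelianGroup.of ⟨S.X₁, h₁⟩ -
        FreeAbelianGroup.of ⟨S.X₃, h₃⟩}

/-- The Grothendieck group of a full subcategory `P` of an abelian category, with respect to the
ambient short exact sequences. -/
abbrev K0On : Type u := FreeAbelianGroup P.FullSubcategory ⧸ relationsOn P

open Classical in
/-- The class of `X` in `K0On P`, which is `0` if `X` does not satisfy `P`. -/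
def cls (X : C) : K0On P :=
  if hX : P X then QuotientAddGroup.mk (FreeAbelianGroup.of ⟨X, hX⟩) else 0

lemma cls_eq {X : C} (hX : P X) : cls P X = QuotientAddGroup.mk (FreeAbelianGroup.of ⟨X, hX⟩) :=
  dif_pos hX

lemma isAdditiveOn_cls : IsAdditiveOn P (cls P) := by
  intro S hS h₁ h₂ h₃
  rw [cls_eq P h₁, cls_eq P h₂, cls_eq P h₃, ← sub_eq_zero, ← sub_sub]
  exact (QuotientAddGroup.eq_zero_iff _).2 (AddSubgroup.subset_closure ⟨S, h₁, h₂, h₃, hS, rfl⟩)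

variable {P} {G : Type*} [AddCommGroup G]

/-- The homomorphism out of `K0On P` induced by an additive function. -/
def K0On.lift (φ : C → G) (hφ : IsAdditiveOn P φ) : K0On P →+ G :=
  QuotientAddGroup.lift _ (FreeAbelianGroup.lift fun X => φ X.obj) (by
    rw [relationsOn, AddSubgroup.closure_le]
    rintro _ ⟨S, h₁, h₂, h₃, hS, rfl⟩
    simp [hφ S hS h₁ h₂ h₃])

lemma K0On.lift_cls (φ : C → G) (hφ : IsAdditiveOn P φ) {X : C} (hX : P X) :
    K0On.lift φ hφ (cls P X) = φ X := by
  rw [cls_eq P hX]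
  simp [K0On.lift]

lemma K0On.hom_ext {f g : K0On P →+ G} (h : ∀ X, P X → f (cls P X) = g (cls P X)) : f = g := by
  refine QuotientAddGroup.addMonoidHom_ext _ (FreeAbelianGroup.lift_ext _ _ fun X => ?_)
  have := h X.obj X.property
  rwa [cls_eq P X.property] at this

end K0On

end

/-! ### Extending additive functions along coresolutions of length one. -/

noncomputable section

variable {C : Type u} [Category.{v} C] [Abelian C]

/-- For monomorphisms `f : X ⟶ Y` and `g : Y ⟶ Z`, the short exact sequence
`0 ⟶ coker f ⟶ coker (f ≫ g) ⟶ coker g ⟶ 0`. -/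
lemma shortExact_cokernel_comp {X Y Z : C} (f : X ⟶ Y) (g : Y ⟶ Z) [Mono g] :
    (ShortComplex.mk (cokernel.map f (f ≫ g) (𝟙 _) g (by simp))
      (cokernel.map (f ≫ g) g f (𝟙 _) (by simp)) (by cat_disch)).ShortExact := by
  let S := kernelCokernelCompSequence.snakeInput f g
  -- The connecting map of the snake starts at ker g = 0, which makes coker f ⟶ coker (f ≫ g) a
  -- monomorphism.
  have hz : IsZero S.L₀.X₃ := isZero_kernel_of_mono g
  exact
    { exact := S.L₃_exact
      mono_f := S.L₂'_exact.mono_g (hz.eq_of_src _ _)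
      epi_g := by
        have : Epi (cokernel.π (f ≫ g) ≫ cokernel.map (f ≫ g) g f (𝟙 _) (by simp)) := by
          rw [cokernel.π_desc, Category.id_comp]
          infer_instance
        exact epi_of_epi (cokernel.π (f ≫ g)) _ }

lemma shortExact_precomp_iso {S : ShortComplex C} {X : C} (e : X ≅ S.X₁) (hS : S.ShortExact) :
    (ShortComplex.mk (e.hom ≫ S.f) S.g (by simp)).ShortExact :=
  ShortComplex.shortExact_of_iso
    (ShortComplex.isoMk e.symm (Iso.refl _) (Iso.refl _) (by simp) (by simp)) hS

/-- `P₁` is coresolving of length one in the wide subcategory `P`: it is additive, closed under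
quotients and every object of `P` embeds in an object of `P₁`. -/
structure IsCoresolving (P P₁ : ObjectProperty C) : Prop where
  le : P₁ ≤ P
  of_iso {X Y : C} (e : X ≅ Y) (hX : P₁ X) : P₁ Y
  biprod {X Y : C} (hX : P₁ X) (hY : P₁ Y) : P₁ (X ⊞ Y)
  quotient {X Y : C} (f : X ⟶ Y) [Epi f] (hX : P₁ X) (hY : P Y) : P₁ Y
  exists_mono (X : C) (hX : P X) : ∃ (Y : C) (f : X ⟶ Y), Mono f ∧ P₁ Y

namespace IsCoresolving

variable {P P₁ : ObjectProperty C} (h : IsCoresolving P P₁) (hP : IsWide P)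
  {G : Type*} [AddCommGroup G] {φ : C → G} (hφ : IsAdditiveOn P₁ φ)

include h hP

lemma zero : P₁ 0 := by
  obtain ⟨Y, f, _, hY⟩ := h.exists_mono 0 hP.zero
  have : Epi (0 : Y ⟶ 0) := ⟨fun _ _ _ => (isZero_zero C).eq_of_src _ _⟩
  exact h.quotient (0 : Y ⟶ 0) hY hP.zero

lemma cokernel {X Y : C} (f : X ⟶ Y) (hX : P X) (hY : P₁ Y) : P₁ (cokernel f) :=
  h.quotient (cokernel.π f) hY (hP.cokernel f hX (h.le _ hY))

/-- Additive functions on `P` are determined by their values on `P₁`. -/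
lemma eq_of_eq {ψ ψ' : C → G} (hψ : IsAdditiveOn P ψ) (hψ' : IsAdditiveOn P ψ')
    (heq : ∀ X, P₁ X → ψ X = ψ' X) (X : C) (hX : P X) : ψ X = ψ' X := by
  obtain ⟨Y, f, _, hY⟩ := h.exists_mono X hX
  have hc := h.cokernel hP f hX hY
  have h₁ := hψ _ (shortExact_cokernel f) hX (h.le _ hY) (h.le _ hc)
  have h₂ := hψ' _ (shortExact_cokernel f) hX (h.le _ hY) (h.le _ hc)
  dsimp only at h₁ h₂
  rw [← add_left_inj (ψ (Limits.cokernel f)), ← h₁, heq _ hY, heq _ hc, h₂]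

include hφ

/-- Enlarging `Y` to `Z` adds φ(coker g) to both terms of the difference. -/
lemma sub_eq_sub_comp {X Y Z : C} (f : X ⟶ Y) (g : Y ⟶ Z) [Mono g] (hX : P X)
    (hY : P₁ Y) (hZ : P₁ Z) :
    φ Y - φ (Limits.cokernel f) = φ Z - φ (Limits.cokernel (f ≫ g)) := by
  have h₁ := hφ _ (shortExact_cokernel g) hY hZ (h.cokernel hP g (h.le _ hY) hZ)
  have h₂ := hφ _ (shortExact_cokernel_comp f g) (h.cokernel hP f hX hY)
    (h.cokernel hP _ hX hZ) (h.cokernel hP g (h.le _ hY) hZ)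
  dsimp only at h₁ h₂
  rw [h₁, h₂]
  abel

/-- The value `φ Y - φ (Y / X)` does not depend on the embedding of `X` in an object of `P₁`. -/
lemma sub_eq_sub {X Y Z : C} (f : X ⟶ Y) (g : X ⟶ Z) [Mono f] [Mono g] (hX : P X)
    (hY : P₁ Y) (hZ : P₁ Z) :
    φ Y - φ (Limits.cokernel f) = φ Z - φ (Limits.cokernel g) := by
  -- The pushout contains both `Y` and `Z`, compatibly with `X`. It is the cokernel of a map X ⟶ Y ⊞
  -- Z, hence lies in `P₁`.
  have sq := IsPushout.of_hasPushout f g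
  have hW : P₁ (pushout f g) := by
    refine h.of_iso (sq.isColimitCokernelCofork.coconePointUniqueUpToIso
      (cokernelIsCokernel _)).symm (h.cokernel hP _ hX (h.biprod hY hZ))
  rw [h.sub_eq_sub_comp hP hφ f (pushout.inl f g) hX hY hW,
    h.sub_eq_sub_comp hP hφ g (pushout.inr f g) hX hZ hW]
  simp only [pushout.condition]

/-- An additive function on `P₁` extends to an additive function on `P`. -/
lemma exists_extension : ∃ ψ : C → G, IsAdditiveOn P ψ ∧ ∀ X, P₁ X → ψ X = φ X := by
  classical
  choose! E i hi hE using h.exists_mono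
  have key {X Y : C} (f : X ⟶ Y) [Mono f] (hX : P X) (hY : P₁ Y) :
      φ (E X) - φ (Limits.cokernel (i X)) = φ Y - φ (Limits.cokernel f) := by
    have := hi X hX
    exact h.sub_eq_sub hP hφ _ _ hX (hE X hX) hY
  refine ⟨fun X => φ (E X) - φ (Limits.cokernel (i X)), fun S hS h₁ h₂ h₃ => ?_, fun X hX => ?_⟩
  · have := hi _ h₂
    have := hS.mono_f
    have := hS.epi_g
    -- One embedding of X₂ in E serves all three terms: X₁ embeds in E with cokernel E/X₁, and X₃ ≅
    -- X₂/X₁ embeds in E/X₁ with cokernel E/X₂. The differences then telescope.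
    let j := i S.X₂
    have hj := shortExact_cokernel_comp S.f j
    have := hj.mono_f
    dsimp only at this
    let e : S.X₃ ≅ Limits.cokernel S.f :=
      hS.gIsCokernel.coconePointUniqueUpToIso (colimit.isColimit _)
    have hc := h.cokernel hP (S.f ≫ j) h₁ (hE _ h₂)
    have hc' := h.cokernel hP j h₂ (hE _ h₂)
    let q : S.X₃ ⟶ Limits.cokernel (S.f ≫ j) :=
      e.hom ≫ cokernel.map S.f (S.f ≫ j) (𝟙 _) j (by simp)
    have hq := shortExact_precomp_iso e hj
    have eq : φ (Limits.cokernel q) = φ (Limits.cokernel j) := by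
      let e' : Limits.cokernel q ≅ Limits.cokernel j :=
        (colimit.isColimit _).coconePointUniqueUpToIso hq.gIsCokernel
      have hcq := h.of_iso e'.symm hc'
      exact hφ.map_iso (h.zero hP) e' hcq hc'
    have : Mono q := hq.mono_f
    dsimp only
    rw [key (S.f ≫ j) h₁ (hE _ h₂), key q h₃ hc, eq]
    abel
  · dsimp only
    rw [key (𝟙 X) (h.le _ hX) hX]
    have := h.cokernel hP (𝟙 X) (h.le _ hX) hX
    rw [hφ.map_isZero (isZero_cokernel_of_epi (𝟙 X)) this, sub_zero]

end IsCoresolving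

end

/-! ### Sums of copies of `T` and coreflections. -/

noncomputable section

variable {C : Type u} [Category.{v} C] [Abelian C]

/-- `IsPower T a F` says that `F` is a direct sum of `a` copies of `T`. -/
inductive IsPower (T : C) : ℕ → C → Prop
  | zero : IsPower T 0 0
  | self : IsPower T 1 T
  | biprod {a b : ℕ} {F G : C} (hF : IsPower T a F) (hG : IsPower T b G) :
      IsPower T (a + b) (F ⊞ G)

namespace IsPower

variable {T : C} {a : ℕ} {F : C}

lemma prop {P : ObjectProperty C} (hP : IsWide P) (hT : P T) (hF : IsPower T a F) : P F := by
  induction hF with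
  | zero => exact hP.zero
  | self => exact hT
  | biprod _ _ h₁ h₂ => exact hP.biprod h₁ h₂

lemma subsingleton_ext [HasExt.{w} C] {X : C} {i : ℕ} (hX : Subsingleton (Ext.{w} X T i))
    (hF : IsPower T a F) : Subsingleton (Ext.{w} X F i) := by
  induction hF with
  | zero =>
    rw [ext_subsingleton_iff]
    intro x
    rw [← Ext.comp_mk₀_id x, (isZero_zero C).eq_of_src (𝟙 (0 : C)) 0, Ext.mk₀_zero, Ext.comp_zero]
  | self => exact hX
  | biprod _ _ h₁ h₂ => exact Ext.addEquivBiprod.toEquiv.subsingleton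

lemma map_eq {G : Type*} [AddCommGroup G] {P : ObjectProperty C} {φ : C → G}
    (hφ : IsAdditiveOn P φ) (hP : IsWide P) (hT : P T) (hF : IsPower T a F) : φ F = a • φ T := by
  induction hF with
  | zero => rw [hφ.map_isZero (isZero_zero C) hP.zero, zero_smul]
  | self => rw [one_smul]
  | @biprod a b F G hF hG h₁ h₂ =>
    rw [add_smul, ← h₁, ← h₂]
    exact hφ _ (ShortComplex.Splitting.ofHasBinaryBiproduct F G).shortExact (hF.prop hP hT)
      (hP.biprod (hF.prop hP hT) (hG.prop hP hT)) (hG.prop hP hT)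

lemma finrank_hom {k : Type t} [Field k] [Linear k C] (hfin : ∀ X Y : C, Module.Finite k (X ⟶ Y))
    (hF : IsPower T a F) :
    Module.finrank k (T ⟶ F) = a * Module.finrank k (T ⟶ T) := by
  induction hF with
  | zero =>
    have : Subsingleton (T ⟶ (0 : C)) := ⟨fun _ _ => (isZero_zero C).eq_of_tgt _ _⟩
    rw [Module.finrank_zero_of_subsingleton, zero_mul]
  | self => rw [one_mul]
  | @biprod a b F G _ _ h₁ h₂ =>
    have e : (T ⟶ F ⊞ G) ≃ₗ[k] (T ⟶ F) × (T ⟶ G) :=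
      { toFun u := (u ≫ biprod.fst, u ≫ biprod.snd)
        invFun u := biprod.lift u.1 u.2
        map_add' u v := by simp
        map_smul' r u := by simp
        left_inv u := by ext <;> simp
        right_inv u := by simp }
    rw [e.finrank_eq, Module.finrank_prod, h₁, h₂, add_mul]

lemma lift_of_lift {X Y : C} (f : X ⟶ Y) (hf : ∀ u : T ⟶ Y, ∃ v, v ≫ f = u)
    (hF : IsPower T a F) (u : F ⟶ Y) : ∃ v, v ≫ f = u := by
  induction hF with
  | zero => exact ⟨0, (isZero_zero C).eq_of_src _ _⟩
  | self => exact hf u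
  | biprod _ _ h₁ h₂ =>
    obtain ⟨v₁, hv₁⟩ := h₁ (biprod.inl ≫ u)
    obtain ⟨v₂, hv₂⟩ := h₂ (biprod.inr ≫ u)
    exact ⟨biprod.desc v₁ v₂, by ext <;> simp [hv₁, hv₂]⟩

lemma eq_zero_of_comp {X Y : C} (f : X ⟶ Y) (hf : ∀ u : T ⟶ X, u ≫ f = 0 → u = 0)
    (hF : IsPower T a F) (u : F ⟶ X) (hu : u ≫ f = 0) : u = 0 := by
  induction hF with
  | zero => exact (isZero_zero C).eq_of_src _ _
  | self => exact hf u hu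
  | biprod _ _ h₁ h₂ =>
    ext
    · rw [h₁ (biprod.inl ≫ u) (by rw [Category.assoc, hu, comp_zero]), comp_zero]
    · rw [h₂ (biprod.inr ≫ u) (by rw [Category.assoc, hu, comp_zero]), comp_zero]

end IsPower

/-- `f : F ⟶ X` is a coreflection of `X` in the sums of copies of `T`: the object `F` is a sum of
`a` copies of `T` and every `T ⟶ X` factors uniquely through `f`. -/
structure IsCoreflection (T : C) (a : ℕ) {F X : C} (f : F ⟶ X) : Prop where
  isPower : IsPower T a F
  eq_zero (u : T ⟶ F) (hu : u ≫ f = 0) : u = 0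
  exists_lift (u : T ⟶ X) : ∃ v, v ≫ f = u

namespace IsCoreflection

variable {T : C} {a : ℕ}

/-- Coreflections of the outer terms of a short exact sequence give one of the middle term. -/
lemma biprod {b : ℕ} {S : ShortComplex C} (hS : S.ShortExact) {F₁ F₃ : C} {f₁ : F₁ ⟶ S.X₁}
    {f₃ : F₃ ⟶ S.X₃} (h₁ : IsCoreflection T a f₁) (h₃ : IsCoreflection T b f₃) (s : F₃ ⟶ S.X₂)
    (hs : s ≫ S.g = f₃) : IsCoreflection T (a + b) (biprod.desc (f₁ ≫ S.f) s) where
  isPower := h₁.isPower.biprod h₃.isPower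
  eq_zero u hu := by
    have := hS.mono_f
    have hu' : u = biprod.lift (u ≫ biprod.fst) (u ≫ biprod.snd) := by ext <;> simp
    rw [hu', biprod.lift_desc] at hu
    have h₂ : u ≫ biprod.snd = 0 := h₃.eq_zero _ (by
      simpa [← hs] using hu =≫ S.g)
    have h₁ : u ≫ biprod.fst = 0 := h₁.eq_zero _ (by
      rw [← cancel_mono S.f]
      simpa [h₂] using hu)
    rw [hu', h₁, h₂]
    ext <;> simp
  exists_lift u := by
    have := hS.mono_f
    -- After the image of `u` in X₃ is lifted, the error u - v₃ ≫ s lands in X₁ and lifts there.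
    obtain ⟨v₃, hv₃⟩ := h₃.exists_lift (u ≫ S.g)
    obtain ⟨v₁, hv₁⟩ := h₁.exists_lift (hS.exact.lift (u - v₃ ≫ s) (by simp [hs, hv₃]))
    refine ⟨biprod.lift v₁ v₃, ?_⟩
    rw [biprod.lift_desc, reassoc_of% hv₁, hS.exact.lift_f]
    simp

variable {F X : C} {f : F ⟶ X} (hf : IsCoreflection T a f)

include hf

/-- Composition with `f` identifies Hom(T, F) with Hom(T, X); this makes the number `a` of copies an
invariant of `X`. -/
lemma finrank_hom {k : Type t} [Field k] [Linear k C]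
    (hfin : ∀ X Y : C, Module.Finite k (X ⟶ Y)) :
    Module.finrank k (T ⟶ X) = a * Module.finrank k (T ⟶ T) := by
  rw [← hf.isPower.finrank_hom hfin]
  refine (LinearEquiv.finrank_eq (LinearEquiv.ofBijective (Linear.rightComp k T f) ⟨?_, ?_⟩)).symm
  · exact (injective_iff_map_eq_zero _).2 hf.eq_zero
  · exact hf.exists_lift

/-- The usual uniqueness argument: the universal property, stated for maps from `T`, extends to maps
from sums of copies of `T`. -/
lemma exists_iso {b : ℕ} {F' : C} {f' : F' ⟶ X} (hf' : IsCoreflection T b f') :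
    ∃ e : F ≅ F', e.hom ≫ f' = f := by
  obtain ⟨v, hv⟩ := hf.isPower.lift_of_lift f' hf'.exists_lift f
  obtain ⟨v', hv'⟩ := hf'.isPower.lift_of_lift f hf.exists_lift f'
  refine ⟨⟨v, v', ?_, ?_⟩, hv⟩
  · rw [← sub_eq_zero]
    exact hf.isPower.eq_zero_of_comp f hf.eq_zero _ (by simp [hv, hv'])
  · rw [← sub_eq_zero]
    exact hf'.isPower.eq_zero_of_comp f' hf'.eq_zero _ (by simp [hv, hv'])

end IsCoreflection

/-- Existence of coreflections when `End T` is a division ring. -/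
lemma exists_isCoreflection {k : Type t} [Field k] [Linear k C]
    (hfin : ∀ X Y : C, Module.Finite k (X ⟶ Y)) {T : C} (hT : Nontrivial (End T))
    (hu : ∀ f : End T, f ≠ 0 → IsUnit f) (X : C) :
    ∃ (a : ℕ) (F : C) (f : F ⟶ X), IsCoreflection T a f := by
  have hpos : 0 < Module.finrank k (T ⟶ T) :=
    have : Nontrivial (T ⟶ T) := hT
    Module.finrank_pos
  suffices H : ∀ (d a : ℕ) (F : C) (f : F ⟶ X), IsPower T a F → (∀ u : T ⟶ F, u ≫ f = 0 → u = 0) →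
      Module.finrank k (T ⟶ X) ≤ Module.finrank k (T ⟶ F) + d →
      ∃ (a : ℕ) (F : C) (f : F ⟶ X), IsCoreflection T a f from
    H (Module.finrank k (T ⟶ X)) 0 0 0 .zero (fun _ _ => (isZero_zero C).eq_of_tgt _ _) (by omega)
  -- Induction on a bound `d` for dim Hom(T, X) - dim Hom(T, F), adding one copy of `T` whenever
  -- some map T ⟶ X does not factor through `f`.
  intro d
  induction d with
  | zero =>
    intro a F f hF hf hd
    refine ⟨a, F, f, hF, hf, fun u => ?_⟩
    have hinj : Function.Injective (Linear.rightComp k T f) :=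
      (injective_iff_map_eq_zero _).2 hf
    exact (LinearMap.injective_iff_surjective_of_finrank_eq_finrank
      (le_antisymm (LinearMap.finrank_le_finrank_of_injective hinj) hd)).1 hinj u
  | succ d ih =>
    intro a F f hF hf hd
    by_cases hs : ∀ u : T ⟶ X, ∃ v, v ≫ f = u
    · exact ⟨a, F, f, hF, hf, hs⟩
    push Not at hs
    obtain ⟨g, hg⟩ := hs
    have hF' : IsPower T (a + 1) (F ⊞ T) := hF.biprod .self
    refine ih (a + 1) (F ⊞ T) (biprod.desc f g) hF' (fun u h => ?_) ?_
    · have hu' : u = biprod.lift (u ≫ biprod.fst) (u ≫ biprod.snd) := by ext <;> simp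
      rw [hu', biprod.lift_desc] at h
      have h₂ : u ≫ biprod.snd = 0 := by
        -- A nonzero component in End T is invertible, so the relation could be solved for `g`,
        -- which would then factor through `f`.
        by_contra hne
        obtain ⟨w, hw⟩ := (hu (u ≫ biprod.snd) hne).exists_right_inv
        have hw' : w ≫ u ≫ biprod.snd = 𝟙 T := hw
        refine hg (-(w ≫ u ≫ biprod.fst)) ?_
        have := w ≫= h
        rw [Preadditive.comp_add, comp_zero, Category.assoc, Category.assoc,
          reassoc_of% hw', ← eq_neg_iff_add_eq_zero] at this
        simp [this]
      have h₁ : u ≫ biprod.fst = 0 := hf _ (by simpa [h₂] using h)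
      rw [hu', h₁, h₂]
      ext <;> simp
    -- The new copy raises the dimension by dim End T ≥ 1, which absorbs one unit of the bound.
    · rw [hF'.finrank_hom hfin]
      rw [hF.finrank_hom hfin] at hd
      rw [add_mul]
      omega

end

/-! ### Objects with Ext¹(T, X) = 0. -/

noncomputable section

variable {C : Type u} [Category.{v} C] [Abelian C] [HasExt.{w} C]

/-- The objects `X` with `Ext¹(T, X) = 0`. -/
def extOneAcyclic (T : C) : ObjectProperty C := fun X => Subsingleton (Ext.{w} T X 1)

section Coresolving

variable {T : C} {k : Type t} [Field k] [Linear k C]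

/-- Every `X` embeds in an object without first extensions by `T`, obtained as an
iterated extension of copies of `T` by `X`. -/
lemma exists_mono_extOneAcyclic (hfin : ∀ X Y : C, Module.Finite k (Ext.{w} X Y 1))
    (hT : Subsingleton (Ext.{w} T T 1)) {P : ObjectProperty C} (hP : IsWide P) (hPT : P T) (X : C)
    (hX : P X) : ∃ (Y : C) (f : X ⟶ Y), Mono f ∧ (P ⊓ extOneAcyclic.{w} T) Y := by
  suffices H : ∀ (d : ℕ) (X : C), P X → Module.finrank k (Ext.{w} T X 1) ≤ d →
      ∃ (Y : C) (f : X ⟶ Y), Mono f ∧ (P ⊓ extOneAcyclic.{w} T) Y from H _ X hX le_rfl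
  intro d
  induction d with
  | zero =>
    intro X hX hd
    exact ⟨X, 𝟙 X, inferInstance, hX,
      Module.finrank_zero_iff.1 (Nat.le_zero.1 hd)⟩
  | succ d ih =>
    intro X hX hd
    by_cases hs : Subsingleton (Ext.{w} T X 1)
    · exact ⟨X, 𝟙 X, inferInstance, hX, hs⟩
    rw [ext_subsingleton_iff] at hs
    push Not at hs
    obtain ⟨e, he⟩ := hs
    -- Passing to the extension E kills `e`, and Ext¹(T, X) ⟶ Ext¹(T, E) is onto because Ext¹(T, T)
    -- = 0. The dimension therefore drops strictly.
    obtain ⟨E, f, g, w, hS, hef⟩ := exists_shortExact_comp_eq_zero e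
    have hmono : Mono f := hS.mono_f
    let L : Ext.{w} T X 1 →ₗ[k] Ext.{w} T E 1 :=
      { toFun x := x.comp (Ext.mk₀ f) (add_zero 1)
        map_add' x y := Ext.add_comp _ _ _ _
        map_smul' r x := Ext.smul_comp _ _ _ _ }
    have hL : Function.Surjective L := fun x =>
      Ext.covariant_sequence_exact₂ T hS x (hT.elim _ _)
    have hker : 0 < Module.finrank k (LinearMap.ker L) := by
      have : Nontrivial (LinearMap.ker L) :=
        ⟨⟨⟨e, hef⟩, 0, fun h => he (congrArg Subtype.val h)⟩⟩
      exact Module.finrank_pos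
    have hrk := L.finrank_range_add_finrank_ker
    rw [LinearMap.range_eq_top.2 hL, finrank_top] at hrk
    obtain ⟨Y, i, hi, hY⟩ := ih E (hP.extension hS hX hPT) (by omega)
    exact ⟨Y, f ≫ i, mono_comp f i, hY⟩

variable [HasProjectiveDimensionLE T 1]

lemma ext_eq_zero_of_two_le {X : C} {i : ℕ} (hi : 2 ≤ i) (x : Ext.{w} T X i) : x = 0 :=
  Ext.eq_zero_of_hasProjectiveDimensionLT _ 2 hi

/-- `Ext¹(T, -)` is right exact. -/
lemma surjective_comp_mk₀ {S : ShortComplex C} (hS : S.ShortExact) (x : Ext.{w} T S.X₃ 1) :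
    ∃ y : Ext.{w} T S.X₂ 1, y.comp (Ext.mk₀ S.g) (add_zero 1) = x :=
  Ext.covariant_sequence_exact₃ T hS x rfl (ext_eq_zero_of_two_le le_rfl _)

lemma extOneAcyclic_of_epi {X Y : C} (f : X ⟶ Y) [Epi f] (hX : extOneAcyclic.{w} T X) :
    extOneAcyclic.{w} T Y := by
  have hS : (ShortComplex.mk (kernel.ι f) f (kernel.condition f)).ShortExact :=
    { exact := ShortComplex.exact_kernel f }
  rw [extOneAcyclic, ext_subsingleton_iff]
  intro x
  obtain ⟨y, rfl⟩ := surjective_comp_mk₀ hS x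
  rw [hX.elim y 0, Ext.zero_comp]

lemma isCoresolving_extOneAcyclic (hfin : ∀ X Y : C, Module.Finite k (Ext.{w} X Y 1))
    (hT : Subsingleton (Ext.{w} T T 1)) {P : ObjectProperty C} (hP : IsWide P) (hPT : P T) :
    IsCoresolving P (P ⊓ extOneAcyclic.{w} T) where
  le := inf_le_left
  of_iso e hX := ⟨hP.of_iso e hX.1, extOneAcyclic_of_epi e.hom hX.2⟩
  biprod hX hY := by
    refine ⟨hP.biprod hX.1 hY.1, ?_⟩
    have := hX.2
    have := hY.2
    unfold extOneAcyclic at *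
    exact Ext.addEquivBiprod.toEquiv.subsingleton
  quotient f _ hX hY := ⟨hY, extOneAcyclic_of_epi f hX.2⟩
  exists_mono X hX := exists_mono_extOneAcyclic hfin hT hP hPT X hX

end Coresolving

/-! ### The perpendicular category and coreflections. -/

section Perp

lemma rightPerp_extension {T : C} {S : ShortComplex C} (hS : S.ShortExact)
    (h₁ : rightPerp.{w} T S.X₁) (h₃ : rightPerp.{w} T S.X₃) : rightPerp.{w} T S.X₂ := by
  intro i
  rw [ext_subsingleton_iff]
  intro x
  obtain ⟨y, rfl⟩ := Ext.covariant_sequence_exact₂ T hS x ((h₃ i).elim _ _)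
  rw [(h₁ i).elim y 0, Ext.zero_comp]

variable {T : C}

lemma subsingleton_ext_zero {X : C} (h : ∀ u : T ⟶ X, u = 0) : Subsingleton (Ext.{w} T X 0) := by
  rw [ext_subsingleton_iff]
  intro x
  obtain ⟨u, rfl⟩ := Ext.mk₀_bijective T X |>.2 x
  rw [h u, Ext.mk₀_zero]

lemma hom_eq_zero_of_rightPerp {X : C} (hX : rightPerp.{w} T X) (u : T ⟶ X) : u = 0 :=
  (Ext.mk₀_bijective T X).1 ((hX 0).elim _ _)

variable [HasProjectiveDimensionLE T 1]

/-- This is what lets the induction stay among wide subcategories of the fixed category `C`. -/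
lemma isWide_inf_rightPerp {P : ObjectProperty C} (hP : IsWide P) :
    IsWide (P ⊓ rightPerp.{w} T) where
  of_iso e hX := ⟨hP.of_iso e hX.1, rightPerp_of_iso T e hX.2⟩
  zero := ⟨hP.zero, (rightPerp.{w} T).prop_of_isZero (isZero_zero C)⟩
  kernel f hX hY := ⟨hP.kernel f hX.1 hY.1, (rightPerp_kernel_cokernel T f hX.2 hY.2).1⟩
  cokernel f hX hY := ⟨hP.cokernel f hX.1 hY.1, (rightPerp_kernel_cokernel T f hX.2 hY.2).2⟩
  extension hS h₁ h₃ := ⟨hP.extension hS h₁.1 h₃.1, rightPerp_extension hS h₁.2 h₃.2⟩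

lemma rightPerp_of_zero_one {X : C} (h₀ : Subsingleton (Ext.{w} T X 0))
    (h₁ : Subsingleton (Ext.{w} T X 1)) : rightPerp.{w} T X
  | 0 => h₀
  | 1 => h₁
  | i + 2 => ext_subsingleton_iff.2 fun x => ext_eq_zero_of_two_le (by omega) x

/-- The kernel and the cokernel of a coreflection are perpendicular to `T`. -/
lemma IsCoreflection.rightPerp_kernel_cokernel (hT : Subsingleton (Ext.{w} T T 1)) {a : ℕ}
    {F X : C} {f : F ⟶ X} (hf : IsCoreflection T a f) (hX : extOneAcyclic.{w} T X) :
    rightPerp.{w} T (kernel f) ∧ rightPerp.{w} T (cokernel f) := by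
  have hF : extOneAcyclic.{w} T F := hf.isPower.subsingleton_ext hT
  have hI : extOneAcyclic.{w} T (Abelian.image f) :=
    extOneAcyclic_of_epi (Abelian.factorThruImage f) hF
  have hS₁ := shortExact_kernel_image f
  have hS₂ := shortExact_image_cokernel f
  constructor
  · refine rightPerp_of_zero_one (subsingleton_ext_zero fun u => ?_) ?_
    · rw [← cancel_mono (kernel.ι f), zero_comp]
      exact hf.eq_zero _ (by simp)
    · rw [ext_subsingleton_iff]
      intro x
      -- Since Ext¹(T, F) = 0, the class is the connecting image of a map T ⟶ im f. That map lifts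
      -- to `F`, so its connecting image vanishes.
      obtain ⟨y, rfl⟩ := Ext.covariant_sequence_exact₁ T hS₁ x (hF.elim _ _) rfl
      obtain ⟨u, rfl⟩ := (Ext.mk₀_bijective T _).2 y
      obtain ⟨v, hv⟩ := hf.exists_lift (u ≫ Abelian.image.ι f)
      have hv' : v ≫ Abelian.factorThruImage f = u := by
        rw [← cancel_mono (Abelian.image.ι f)]
        simpa using hv
      rw [← hv', ← Ext.mk₀_comp_mk₀, Ext.comp_assoc_of_second_deg_zero, hS₁.comp_extClass,
        Ext.comp_zero]
  · refine rightPerp_of_zero_one (subsingleton_ext_zero fun u => ?_)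
      (extOneAcyclic_of_epi (cokernel.π f) hX)
    -- A map T ⟶ coker f lifts to `X` because Ext¹(T, im f) = 0; the lift factors through `f`, so
    -- the original map is zero.
    obtain ⟨y, hy⟩ := Ext.covariant_sequence_exact₃ T hS₂ (Ext.mk₀ u) rfl (hI.elim _ _)
    obtain ⟨v, rfl⟩ := (Ext.mk₀_bijective T _).2 y
    obtain ⟨z, rfl⟩ := hf.exists_lift v
    apply (Ext.mk₀_bijective T _).1
    rw [← hy, Ext.mk₀_comp_mk₀]
    simp

end Perp

end

noncomputable section

variable {k : Type t} [Field k] {C : Type u} [Category.{v} C] [Abelian C] [Linear k C]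
  [HasExt.{w} C]

lemma IsExtFinite.finite_hom (hC : IsExtFinite.{w} k C) (X Y : C) : Module.Finite k (X ⟶ Y) :=
  have := hC.finite_ext X Y 0
  Module.Finite.equiv (Ext.linearEquiv₀ (R := k) (X := X) (Y := Y))

/-! ### Splitting off one exceptional object. -/

section Step

variable {T : C} {P : ObjectProperty C}

/-- The function `X ↦ (a, [coker f] - [ker f])` for a coreflection `f : T ^ a ⟶ X`, which is
additive on the objects with `Ext¹(T, X) = 0`. -/
lemma exists_isAdditiveOn_coreflection [HasProjectiveDimensionLE T 1] (hC : IsExtFinite.{w} k C)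
    (hT : IsExceptional.{w} T) (hP : IsWide P) (hPT : P T) {G : Type*} [AddCommGroup G] {φ : C → G}
    (hφ : IsAdditiveOn (P ⊓ rightPerp.{w} T) φ) :
    ∃ r : C → ℤ × G, IsAdditiveOn (P ⊓ extOneAcyclic.{w} T) r ∧
      ∀ (X : C) (a : ℕ) (F : C) (f : F ⟶ X), (P ⊓ extOneAcyclic.{w} T) X →
        IsCoreflection T a f → r X = ((a : ℤ), φ (cokernel f) - φ (kernel f)) := by
  have hfin := hC.finite_hom
  have hT₁ := hT.ext_eq_zero 1 one_pos
  have hQ : IsWide (P ⊓ rightPerp.{w} T) := isWide_inf_rightPerp hP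
  have hmem {X F : C} {a : ℕ} {f : F ⟶ X} (hX : (P ⊓ extOneAcyclic.{w} T) X)
      (hf : IsCoreflection T a f) :
      (P ⊓ rightPerp.{w} T) (kernel f) ∧ (P ⊓ rightPerp.{w} T) (cokernel f) := by
    have h := hf.rightPerp_kernel_cokernel hT₁ hX.2
    have hF := hf.isPower.prop hP hPT
    exact ⟨⟨hP.kernel f hF hX.1, h.1⟩, ⟨hP.cokernel f hF hX.1, h.2⟩⟩
  choose a F f hf using
    exists_isCoreflection (k := k) hfin hT.nontrivial_end hT.isUnit_of_ne_zero
  have key (X : C) (b : ℕ) (F' : C) (f' : F' ⟶ X) (hX : (P ⊓ extOneAcyclic.{w} T) X)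
      (hf' : IsCoreflection T b f') :
      ((a X : ℤ), φ (cokernel (f X)) - φ (kernel (f X))) =
        ((b : ℤ), φ (cokernel f') - φ (kernel f')) := by
    obtain ⟨e, he⟩ := (hf X).exists_iso hf'
    have hpos : 0 < Module.finrank k (T ⟶ T) :=
      have : Nontrivial (T ⟶ T) := hT.nontrivial_end
      have := hfin T T
      Module.finrank_pos
    have hab : a X = b := Nat.eq_of_mul_eq_mul_right hpos
      (((hf X).finrank_hom hfin).symm.trans (hf'.finrank_hom hfin))
    have h₁ : φ (cokernel (f X)) = φ (cokernel f') :=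
      hφ.map_iso hQ.zero (cokernel.mapIso _ _ e (Iso.refl X) (by simp [he]))
        (hmem hX (hf X)).2 (hmem hX hf').2
    have h₂ : φ (kernel (f X)) = φ (kernel f') :=
      hφ.map_iso hQ.zero (kernel.mapIso _ _ e (Iso.refl X) (by simp [he]))
        (hmem hX (hf X)).1 (hmem hX hf').1
    rw [hab, h₁, h₂]
  refine ⟨fun X => ((a X : ℤ), φ (cokernel (f X)) - φ (kernel (f X))), fun S hS h₁ h₂ h₃ => ?_, key⟩
  -- Ext¹(T, X₁) = 0 lets maps T ⟶ X₃ lift to X₂, which supplies the section-like map `s` needed for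
  -- the combined coreflection.
  have hlift : ∀ u : T ⟶ S.X₃, ∃ v, v ≫ S.g = u := by
    intro u
    obtain ⟨y, hy⟩ := Ext.covariant_sequence_exact₃ T hS (Ext.mk₀ u) rfl (h₁.2.elim _ _)
    obtain ⟨v, rfl⟩ := (Ext.mk₀_bijective T _).2 y
    exact ⟨v, (Ext.mk₀_bijective T _).1 (by rw [← hy, Ext.mk₀_comp_mk₀])⟩
  obtain ⟨s, hs⟩ := (hf S.X₃).isPower.lift_of_lift S.g hlift (f S.X₃)
  have hf₂ := IsCoreflection.biprod hS (hf S.X₁) (hf S.X₃) s hs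
  let f₂ : F S.X₁ ⊞ F S.X₃ ⟶ S.X₂ := biprod.desc (f S.X₁ ≫ S.f) s
  let α : ShortComplex.mk (biprod.inl : F S.X₁ ⟶ F S.X₁ ⊞ F S.X₃) biprod.snd (by simp) ⟶ S :=
    { τ₁ := f S.X₁, τ₂ := biprod.desc (f S.X₁ ≫ S.f) s, τ₃ := f S.X₃
      comm₁₂ := by simp
      comm₂₃ := by dsimp only; ext <;> simp [hs] }
  have hsnake := hφ.map_cokernel_sub_map_kernel hQ α
    (ShortComplex.Splitting.ofHasBinaryBiproduct _ _).shortExact hS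
    (hmem h₁ (hf S.X₁)).1 (hmem h₂ hf₂).1 (hmem h₃ (hf S.X₃)).1
    (hmem h₁ (hf S.X₁)).2 (hmem h₂ hf₂).2 (hmem h₃ (hf S.X₃)).2
  dsimp only
  rw [key S.X₂ _ _ _ h₂ hf₂, Prod.mk_add_mk, Nat.cast_add]
  exact Prod.ext rfl hsnake

/-- Splitting off one exceptional object of projective dimension at most one. -/
lemma nonempty_equiv_of_isExceptional [HasProjectiveDimensionLE T 1] (hC : IsExtFinite.{w} k C)
    (hT : IsExceptional.{w} T) (hP : IsWide P) (hPT : P T) :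
    Nonempty (K0On P ≃+ ℤ × K0On (P ⊓ rightPerp.{w} T)) := by
  have hT₁ := hT.ext_eq_zero 1 one_pos
  have hQ : IsWide (P ⊓ rightPerp.{w} T) := isWide_inf_rightPerp hP
  have hφ := isAdditiveOn_cls (P ⊓ rightPerp.{w} T)
  have hcls := isAdditiveOn_cls P
  obtain ⟨r, hr, hrX⟩ := exists_isAdditiveOn_coreflection hC hT hP hPT hφ
  have hco := isCoresolving_extOneAcyclic (fun X Y => hC.finite_ext X Y 1) hT₁ hP hPT
  obtain ⟨ψ, hψ, hψr⟩ := hco.exists_extension hP hr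
  let A : K0On P →+ ℤ × K0On (P ⊓ rightPerp.{w} T) := K0On.lift ψ hψ
  let ι : K0On (P ⊓ rightPerp.{w} T) →+ K0On P := K0On.lift (cls P) (hcls.mono inf_le_left)
  let B : ℤ × K0On (P ⊓ rightPerp.{w} T) →+ K0On P :=
    AddMonoidHom.coprod (zmultiplesHom _ (cls P T)) ι
  have hAT : A (cls P T) = (1, 0) := by
    have hco1 : IsCoreflection T 1 (𝟙 T) := ⟨.self, by simp, by simp⟩
    rw [K0On.lift_cls ψ hψ hPT, hψr T ⟨hPT, hT₁⟩, hrX T _ _ _ ⟨hPT, hT₁⟩ hco1,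
      hφ.map_isZero (isZero_cokernel_of_epi _) (hQ.of_isZero (isZero_cokernel_of_epi _)),
      hφ.map_isZero (isZero_kernel_of_mono _) (hQ.of_isZero (isZero_kernel_of_mono _))]
    simp
  have hAι (y : K0On (P ⊓ rightPerp.{w} T)) : A (ι y) = (0, y) := by
    suffices H : A.comp ι = AddMonoidHom.inr _ _ from DFunLike.congr_fun H y
    refine K0On.hom_ext fun X hX => ?_
    have hX' : (P ⊓ extOneAcyclic.{w} T) X := ⟨hX.1, hX.2 1⟩
    -- An object of T^⊥ receives no nonzero map from `T`, so its coreflection is 0, with kernel 0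
    -- and cokernel `X`.
    have hco0 : IsCoreflection T 0 (0 : 0 ⟶ X) :=
      ⟨.zero, fun _ _ => (isZero_zero C).eq_of_tgt _ _,
        fun u => ⟨0, by rw [hom_eq_zero_of_rightPerp hX.2 u, zero_comp]⟩⟩
    have : Mono (0 : 0 ⟶ X) := ⟨fun _ _ _ => (isZero_zero C).eq_of_tgt _ _⟩
    rw [AddMonoidHom.comp_apply, K0On.lift_cls _ _ hX, K0On.lift_cls _ _ hX.1, hψr X hX',
      hrX X _ _ _ hX' hco0,
      hφ.map_isZero (isZero_kernel_of_mono _) (hQ.of_isZero (isZero_kernel_of_mono _)),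
      hφ.map_iso hQ.zero cokernelZeroIsoTarget (hQ.of_iso cokernelZeroIsoTarget.symm hX) hX]
    simp
  refine ⟨AddEquiv.ofBijective A (Function.bijective_iff_has_inverse.2 ⟨B, fun x => ?_, ?_⟩)⟩
  · suffices H : B.comp A = AddMonoidHom.id _ from DFunLike.congr_fun H x
    refine K0On.hom_ext fun X hX => ?_
    have hB : IsAdditiveOn P fun X => B (ψ X) := fun S hS h₁ h₂ h₃ => by
      simp only [hψ S hS h₁ h₂ h₃, map_add]
    rw [AddMonoidHom.comp_apply, K0On.lift_cls _ _ hX, AddMonoidHom.id_apply]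
    -- Both functions are additive on `P`, so it is enough to compare them on objects with Ext¹(T,
    -- X) = 0, where a coreflection gives [X] = a[T] + [coker f] - [ker f].
    refine hco.eq_of_eq hP hB hcls (fun X hX => ?_) X hX
    obtain ⟨a, F, f, hf⟩ := exists_isCoreflection (k := k) hC.finite_hom hT.nontrivial_end
      hT.isUnit_of_ne_zero X
    have hF := hf.isPower.prop hP hPT
    have h := hf.rightPerp_kernel_cokernel hT₁ hX.2
    have e₁ := hcls.map_eq_kernel_add_image hP f hF hX.1
    have e₂ := hcls.map_eq_image_add_cokernel hP f hF hX.1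
    rw [hf.isPower.map_eq hcls hP hPT] at e₁
    rw [hψr X hX, hrX X _ _ _ hX hf, AddMonoidHom.coprod_apply, map_sub,
      K0On.lift_cls _ _ ⟨hP.cokernel f hF hX.1, h.2⟩, K0On.lift_cls _ _ ⟨hP.kernel f hF hX.1, h.1⟩,
      zmultiplesHom_apply, natCast_zsmul, e₁, e₂]
    abel
  · rintro ⟨m, y⟩
    rw [AddMonoidHom.coprod_apply, map_add, zmultiplesHom_apply, map_zsmul, hAT, hAι]
    simp

end Step

end

noncomputable section

/-! ### Induction over the collection. -/

section Induction

variable {k : Type t} [Field k] {C : Type u} [Category.{v} C] [Abelian C] [Linear k C]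
  [HasExt.{w} C]

/-- The common right perpendicular of a family of objects. -/
def commonPerp {n : ℕ} (T : Fin n → C) : ObjectProperty C := fun X => ∀ i, rightPerp.{w} (T i) X

lemma inf_rightPerp_inf_commonPerp {n : ℕ} (T : Fin (n + 1) → C) (P : ObjectProperty C) :
    P ⊓ rightPerp.{w} (T 0) ⊓ commonPerp.{w} (fun i => T i.succ) = P ⊓ commonPerp.{w} T := by
  rw [inf_assoc]
  congr 1
  ext X
  exact ⟨fun h => Fin.cases h.1 h.2, fun h => ⟨h 0, fun i => h i.succ⟩⟩

lemma commonPerp_eq_rightPerp {n : ℕ} (T : Fin n → C) :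
    commonPerp.{w} T = rightPerp.{w} (⨁ T) := by
  ext X
  have e (i : ℕ) : Ext.{w} (⨁ T) X i ≃ (∀ j, Ext.{w} (T j) X i) :=
    (Ext.biproductAddEquiv (biproduct.isBilimit T) X i).toEquiv
  constructor
  · intro h i
    have (j : Fin n) := h j i
    exact (e i).subsingleton
  · intro h j i
    have := h i
    have := (e i).symm.subsingleton
    -- An element of one factor is extended by 0 to the product, which has at most one element.
    exact ⟨fun a b => by
      classical
      have := congrFun (Subsingleton.elim (Function.update (0 : ∀ j, Ext.{w} (T j) X i) j a)
        (Function.update 0 j b)) j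
      simpa using this⟩

lemma IsExceptionalCollection.tail {n : ℕ} {T : Fin (n + 1) → C}
    (hT : IsExceptionalCollection.{w} T) : IsExceptionalCollection.{w} fun i => T i.succ where
  isExceptional i := hT.isExceptional i.succ
  ext_eq_zero i j hij m := hT.ext_eq_zero i.succ j.succ (Fin.succ_lt_succ_iff.2 hij) m

/-- `ℤ × ℤⁿ ≃ ℤⁿ⁺¹`. -/
def consAddEquiv (n : ℕ) : ℤ × (Fin n → ℤ) ≃+ (Fin (n + 1) → ℤ) :=
  { Fin.consEquiv fun _ => ℤ with
    map_add' x y := by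
      ext i
      refine Fin.cases ?_ (fun i => ?_) i <;> simp [Fin.consEquiv] }

/-- Splitting off an exceptional collection from a wide subcategory containing it. -/
lemma nonempty_equiv_of_isExceptionalCollection (hC : IsExtFinite.{w} k C) {n : ℕ} (T : Fin n → C)
    (hT : IsExceptionalCollection.{w} T) [∀ i, HasProjectiveDimensionLE (T i) 1]
    (P : ObjectProperty C) (hP : IsWide P) (hPT : ∀ i, P (T i)) :
    Nonempty (K0On P ≃+ (Fin n → ℤ) × K0On (P ⊓ commonPerp.{w} T)) := by
  induction n generalizing P with
  | zero =>
    have h : P ⊓ commonPerp.{w} T = P := inf_eq_left.2 fun _ _ i => i.elim0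
    rw [h]
    exact ⟨AddEquiv.uniqueProd.symm⟩
  | succ n ih =>
    obtain ⟨e₁⟩ := nonempty_equiv_of_isExceptional hC (hT.isExceptional 0) hP (hPT 0)
    -- Vanishing of Ext from the first object to the later ones places these in its perpendicular
    -- category.
    obtain ⟨e₂⟩ := ih (fun i => T i.succ) hT.tail (P ⊓ rightPerp.{w} (T 0))
      (isWide_inf_rightPerp hP) fun i =>
        ⟨hPT i.succ, fun m => hT.ext_eq_zero 0 i.succ (Fin.succ_pos i) m⟩
    rw [inf_rightPerp_inf_commonPerp] at e₂
    exact ⟨e₁.trans ((AddEquiv.prodCongr (.refl ℤ) e₂).trans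
      (AddEquiv.prodAssoc.symm.trans (AddEquiv.prodCongr (consAddEquiv n) (.refl _))))⟩

end Induction

/-! ### Comparing ambient and intrinsic Grothendieck groups. -/

section Comparison

variable {C : Type u} [Category.{v} C] [Abelian C]

lemma isWide_top : IsWide (⊤ : ObjectProperty C) where
  of_iso _ _ := trivial
  zero := trivial
  kernel _ _ _ := trivial
  cokernel _ _ _ := trivial
  extension _ _ _ := trivial

/-- The Grothendieck group of an abelian category is that of its improper full subcategory. -/
def k0EquivTop : K0 C ≃+ K0On (⊤ : ObjectProperty C) :=
  QuotientAddGroup.congr _ _ (FreeAbelianGroup.equivOfEquiv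
    { toFun := fun X => ⟨X, trivial⟩, invFun := fun X => X.obj,
      left_inv := fun _ => rfl, right_inv := fun _ => rfl }) (by
    rw [shortExactRelations, relationsOn, AddMonoidHom.map_closure]
    congr 1
    ext x
    constructor
    · rintro ⟨_, ⟨S, hS, rfl⟩, rfl⟩
      exact ⟨S, trivial, trivial, trivial, hS, by simp [FreeAbelianGroup.equivOfEquiv]⟩
    · rintro ⟨S, _, _, _, hS, rfl⟩
      exact ⟨_, ⟨S, hS, rfl⟩, by simp [FreeAbelianGroup.equivOfEquiv]⟩)

variable (P : ObjectProperty C) [P.ContainsZero] [P.IsClosedUnderKernels]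
  [P.IsClosedUnderCokernels] [P.IsClosedUnderFiniteProducts]

/-- Kernels and cokernels are computed in `C`, so the inclusion is exact; being faithful, it also
reflects exactness. -/
lemma shortExact_map_ι_iff (S : ShortComplex P.FullSubcategory) :
    (S.map P.ι).ShortExact ↔ S.ShortExact := by
  have h₁ := P.preservesKernels_ι
  have h₂ := P.preservesCokernels_ι
  have := P.ι.preservesFiniteLimits_of_preservesKernels
  have := P.ι.preservesFiniteColimits_of_preservesCokernels
  refine ⟨fun h => ?_, fun h => ?_⟩
  · have := h.mono_f
    have := h.epi_g
    exact
      { exact := (S.exact_map_iff_of_faithful P.ι).1 h.exact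
        mono_f := P.ι.mono_of_mono_map h.mono_f
        epi_g := P.ι.epi_of_epi_map h.epi_g }
  · exact h.map_of_exact P.ι

lemma shortExactRelations_fullSubcategory :
    shortExactRelations P.FullSubcategory = relationsOn P := by
  rw [shortExactRelations, relationsOn]
  congr 1
  ext x
  constructor
  · rintro ⟨S, hS, rfl⟩
    exact ⟨S.map P.ι, S.X₁.property, S.X₂.property, S.X₃.property,
      (shortExact_map_ι_iff P S).2 hS, rfl⟩
  · rintro ⟨S, h₁, h₂, h₃, hS, rfl⟩
    let S' : ShortComplex P.FullSubcategory :=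
      ShortComplex.mk (X₁ := ⟨S.X₁, h₁⟩) (X₂ := ⟨S.X₂, h₂⟩) (X₃ := ⟨S.X₃, h₃⟩)
        (P.homMk S.f) (P.homMk S.g) (by ext; exact S.zero)
    exact ⟨S', (shortExact_map_ι_iff P S').1 hS, rfl⟩

end Comparison

end

end ExceptionalCollection

theorem mainTheorem8 {k : Type t} [Field k]
    {B : Type u} [Category.{v} B] [Abelian B] [Linear k B] [HasExt.{w} B]
    (hB : IsExtFinite.{w} k B)
    {n : ℕ} (T : Fin n → B)
    (hT : IsExceptionalCollection.{w} T)
    [∀ i, HasProjectiveDimensionLE (T i) 1] :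
    Nonempty (K0 B ≃+ (Fin n → ℤ) × K0 (rightPerp.{w} (⨁ T)).FullSubcategory) := by
  obtain ⟨e⟩ := nonempty_equiv_of_isExceptionalCollection hB T hT ⊤ isWide_top fun _ => trivial
  rw [top_inf_eq, commonPerp_eq_rightPerp] at e
  exact ⟨k0EquivTop.trans (e.trans (AddEquiv.prodCongr (.refl _)
    (QuotientAddGroup.quotientAddEquivOfEq
      (shortExactRelations_fullSubcategory (rightPerp.{w} (⨁ T))).symm)))⟩
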